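/- Let $\mathcal{X},\mathcal{Y}$ be finite sets and let $(X,Y)$ have joint distribution $P_{XY}$ on $\mathcal{X}\times\mathcal{Y}$. All logarithms, entropies and mutual informations are to base $2$. A WAK (Wyner--Ahlswede--K\"orner) code $\tilde\Phi_n=(\tilde\varphi_0,\tilde\varphi_2,\tilde\psi)$ of block length $n$ consists of finite sets $\tilde{\mathcal M}_0^{(n)},\tilde{\mathcal M}_2^{(n)}$, encoders $\tilde\varphi_0:\mathcal{X}^n\to\tilde{\mathcal M}_0^{(n)}$ and $\tilde\varphi_2:\mathcal{Y}^n\to\tilde{\mathcal M}_2^{(n)}$, and a decoder $\tilde\psi:\tilde{\mathcal M}_0^{(n)}\times\tilde{\mathcal M}_2^{(n)}\to\mathcal{Y}^n$. Its error probability is $$\mathrm{P}_{\mathtt{WAK}}(\tilde\Phi_n|P_{XY}^n)=\Pr\{\tilde\psi(\tilde\varphi_0(X^n),\tilde\varphi_2(Y^n))\neq Y^n\},$$ where $(X^n,Y^n)$ consists of $n$ i.i.d. copies of $(X,Y)$. Let $\mathcal{R}^*_{\mathtt{WAK}}(P_{XY})$ be the set of all $(r_0,r_2)\in\mathbb{R}^2$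 for which there is a channel $P_{W|X}$ from $\mathcal{X}$ to a finite set $\mathcal{W}$ with $|\mathcal{W}|\le|\mathcal{X}||\mathcal{Y}|+2$ such that $r_0\ge I(W\wedge X)$ and $r_2\ge H(Y|W)$, where $(W,X,Y)$ has joint distribution $P_{W|X}P_{XY}$. Let $r_0,r_2\in\mathbb{R}$ with $(r_0,r_2)\notin\mathcal{R}^*_{\mathtt{WAK}}(P_{XY})$ and $r_0<H(X)$. Then, for every sequence of WAK codes $\{\tilde\Phi_n\}_{n=1}^\infty$ satisfying $$\limsup_{n\to\infty}\frac1n\log|\tilde{\mathcal M}_0^{(n)}|\le r_0,\qquad \limsup_{n\to\infty}\frac1n\log|\tilde{\mathcal M}_2^{(n)}|\le r_2,$$ it holds that $$\lim_{n\to\infty}\mathrm{P}_{\mathtt{WAK}}(\tilde\Phi_n|P_{XY}^n)=1.$$ -/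

import Mathlib

namespace WAK

noncomputable section

/-- Shannon entropy, in bits, of a mass function on a finite set
(the value of `Real.logb 2` at `0` is `0`, so that `0 log 0 = 0`). -/
def entropy {A : Type*} [Fintype A] (p : A → ℝ) : ℝ :=
  -∑ a, p a * Real.logb 2 (p a)

/-- First marginal of a mass function on a product. -/
def marginalFst {A B : Type*} [Fintype B] (q : A × B → ℝ) : A → ℝ :=
  fun a => ∑ b, q (a, b)

/-- Second marginal of a mass function on a product. -/
def marginalSnd {A B : Type*} [Fintype A] (q : A × B → ℝ) : B → ℝ :=
  fun b => ∑ a, q (a, b)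

/-- Conditional entropy `H(B | A) = H(A, B) - H(A)` of a pair `(A, B)` with joint mass function
`q`. -/
def condEntropy {A B : Type*} [Fintype A] [Fintype B] (q : A × B → ℝ) : ℝ :=
  entropy q - entropy (marginalFst q)

/-- Mutual information `I(A ∧ B) = H(A) + H(B) - H(A, B)` of a pair `(A, B)` with joint mass
function `q`. -/
def mutualInfo {A B : Type*} [Fintype A] [Fintype B] (q : A × B → ℝ) : ℝ :=
  entropy (marginalFst q) + entropy (marginalSnd q) - entropy q

/-- Joint law of `(W, X, Y)`, where `(X, Y)` has law `P` and `W` is the output of the channel `V`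
with input `X` (so `W - X - Y` is a Markov chain); `V x w` is the probability of `w` given `x`. -/
def jointWXY {X Y W : Type*} (P : X × Y → ℝ) (V : X → W → ℝ) : W × X × Y → ℝ :=
  fun t => P (t.2.1, t.2.2) * V t.2.1 t.1

/-- Joint law of `(W, X)`. -/
def jointWX {X Y W : Type*} [Fintype Y] (P : X × Y → ℝ) (V : X → W → ℝ) : W × X → ℝ :=
  fun t => ∑ y, jointWXY P V (t.1, t.2, y)

/-- Joint law of `(W, Y)`. -/
def jointWY {X Y W : Type*} [Fintype X] (P : X × Y → ℝ) (V : X → W → ℝ) : W × Y → ℝ :=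
  fun t => ∑ x, jointWXY P V (t.1, x, t.2)

/-- The single-letter region: all pairs `(r₀, r₂)` for which there is a test channel from `X` to
a set `W` of size at most `|X| |Y| + 2` with `r₀ ≥ I(W ∧ X)` and `r₂ ≥ H(Y | W)`. -/
def region {X Y : Type*} [Fintype X] [Fintype Y] (P : X × Y → ℝ) : Set (ℝ × ℝ) :=
  {r | ∃ k : ℕ, k ≤ Fintype.card X * Fintype.card Y + 2 ∧
    ∃ V : X → Fin k → ℝ, (∀ x, V x ∈ stdSimplex ℝ (Fin k)) ∧
      mutualInfo (jointWX P V) ≤ r.1 ∧ condEntropy (jointWY P V) ≤ r.2}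

/-- A code of block length `n` with message sets `M₀` (helper) and `M₂` (main encoder): the helper
observes `xⁿ`, the main encoder observes `yⁿ`, the decoder estimates `yⁿ`. -/
structure Code (X Y M₀ M₂ : Type*) (n : ℕ) where
  enc₀ : (Fin n → X) → M₀
  enc₂ : (Fin n → Y) → M₂
  dec : M₀ × M₂ → (Fin n → Y)

/-- Probability of a decoding error when `(Xⁿ, Yⁿ)` has mass function `Q`. -/
def errorProb {X Y M₀ M₂ : Type*} [Fintype X] [Fintype Y] [DecidableEq Y] {n : ℕ}
    (Φ : Code X Y M₀ M₂ n) (Q : (Fin n → X) × (Fin n → Y) → ℝ) : ℝ :=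
  ∑ x : Fin n → X, ∑ y : Fin n → Y,
    if Φ.dec (Φ.enc₀ x, Φ.enc₂ y) ≠ y then Q (x, y) else 0

/-- The `n`-fold i.i.d. product of `P`. -/
def iid {X Y : Type*} (P : X × Y → ℝ) (n : ℕ) : (Fin n → X) × (Fin n → Y) → ℝ :=
  fun z => ∏ i, P (z.1 i, z.2 i)

end

end WAK

open Real Finset

/-! The proof is a change of measure. If the probability `ρ` of correct decoding stays above some `ε
> 0` along infinitely many `n`, condition the source on correct decoding. Under the conditioned law
the code makes no error, so the entropy inequalities of the weak converse hold exactly, while the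
conditioning costs only `-log ρ / n`, which vanishes.

Single-letterizing by the chain rule, with `W` made of the helper message, a time index and the past
letters of both sources, gives `H(Y|W) ≤ log |M₂| / n`. Up to the vanishing cost it also bounds `I(W
∧ XY)` by `log |M₀| / n`, and the divergence of the law of `(W, X, Y)` from `P_{W|X} P_{XY}` by zero
(`SingleLetterizes.exists_of_decodable`, `exists_mem_entropyHull_of_code`).

The source is no longer i.i.d., so `W - X - Y` need not be Markov at finite `n`. Convex combinations
of entropy points form a compact set, so a limit point exists; its divergence is zero, and the
equality case of Gibbs' inequality restores both the law `P` and the Markov condition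
(`markov_of_divergence_nonpos`). Carathéodory's theorem then bounds the size of `W`, which puts the
pair in the region (`mem_region_of_mem_convexHull`). -/

/-- Entropy, in nats, of a nonnegative mass function that need not be normalized: for total mass
`t` it is `t` times the entropy of the normalization. -/
noncomputable def eta {A : Type*} [Fintype A] (q : A → ℝ) : ℝ :=
  ∑ a, negMulLog (q a) - negMulLog (∑ a, q a)

/-! ### Gibbs' inequality and the calculus of unnormalized entropy. -/

section Gibbs

variable {A B : Type*} [Fintype A] [Fintype B]

lemma mul_log_sub_log_le {a b : ℝ} (ha : 0 ≤ a) (hb : 0 ≤ b) (hab : b = 0 → a = 0) :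
    a * (log b - log a) ≤ b - a := by
  rcases ha.eq_or_lt with rfl | ha'
  · simpa using hb
  have hb' : 0 < b := hb.lt_of_ne fun h => ha'.ne' (hab h.symm)
  rw [← log_div hb'.ne' ha'.ne']
  calc a * log (b / a) ≤ a * (b / a - 1) := by
        gcongr; exact log_le_sub_one_of_pos (by positivity)
    _ = b - a := by field_simp

lemma eq_of_le_mul_log_sub_log {a b : ℝ} (ha : 0 ≤ a) (hab : b = 0 → a = 0) (hb : 0 ≤ b)
    (h : b - a ≤ a * (log b - log a)) : a = b := by
  rcases ha.eq_or_lt with rfl | ha'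
  · simp at h; linarith
  have hb' : 0 < b := hb.lt_of_ne fun h => ha'.ne' (hab h.symm)
  by_contra hne
  have h1 : log (b / a) < b / a - 1 :=
    log_lt_sub_one_of_pos (by positivity) fun h => hne ((div_eq_one_iff_eq ha'.ne').1 h).symm
  have h2 : a * log (b / a) < a * (b / a - 1) := mul_lt_mul_of_pos_left h1 ha'
  rw [log_div hb'.ne' ha'.ne'] at h2
  have h3 : a * (b / a - 1) = b - a := by field_simp
  linarith

/-- Gibbs' inequality. -/
lemma sum_mul_log_sub_log_le {a b : A → ℝ} (ha : ∀ i, 0 ≤ a i) (hb : ∀ i, 0 ≤ b i)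
    (hab : ∀ i, b i = 0 → a i = 0) :
    ∑ i, a i * (log (b i) - log (a i)) ≤ ∑ i, b i - ∑ i, a i := by
  rw [← sum_sub_distrib]
  exact sum_le_sum fun i _ => mul_log_sub_log_le (ha i) (hb i) (hab i)

/-- The equality case of Gibbs' inequality. -/
lemma eq_of_le_sum_mul_log_sub_log {a b : A → ℝ} (ha : ∀ i, 0 ≤ a i) (hb : ∀ i, 0 ≤ b i)
    (hab : ∀ i, b i = 0 → a i = 0)
    (h : ∑ i, b i - ∑ i, a i ≤ ∑ i, a i * (log (b i) - log (a i))) (i : A) : a i = b i := by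
  have h1 : ∀ i ∈ univ, a i * (log (b i) - log (a i)) ≤ b i - a i :=
    fun i _ => mul_log_sub_log_le (ha i) (hb i) (hab i)
  have h2 := (sum_eq_sum_iff_of_le h1).1 (le_antisymm (sum_le_sum h1)
    (by rw [sum_sub_distrib]; exact h)) i (mem_univ i)
  exact eq_of_le_mul_log_sub_log (ha i) (hab i) (hb i) h2.ge

lemma eta_eq_sum (q : A → ℝ) : eta q = ∑ a, q a * (log (∑ a, q a) - log (q a)) := by
  simp only [eta, negMulLog, mul_sub, sum_sub_distrib, ← sum_mul, neg_mul, sum_neg_distrib]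
  ring

/-- Homogeneity lets weights be absorbed into mass functions: `H(A|W)` is the plain sum of `eta`
over the slices of the joint law, with no division by `P(w)`. -/
lemma eta_smul (c : ℝ) (q : A → ℝ) : eta (c • q) = c * eta q := by
  simp only [eta, Pi.smul_apply, smul_eq_mul, ← mul_sum, negMulLog_mul, sum_add_distrib, ← sum_mul,
    mul_sub]
  ring

lemma eta_of_subsingleton [Subsingleton A] (q : A → ℝ) : eta q = 0 := by
  rcases isEmpty_or_nonempty A with h | ⟨⟨a⟩⟩
  · simp [eta]
  · have : Unique A := ⟨⟨a⟩, fun b => Subsingleton.elim b a⟩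
    simp [eta]

/-- Entropy is at most any cross entropy. -/
lemma eta_le_cross {q b : A → ℝ} (hq : ∀ a, 0 ≤ q a) (hb : ∀ a, 0 ≤ b a)
    (hqb : ∀ a, b a = 0 → q a = 0) :
    eta q ≤ ∑ a, q a * (log (∑ a, b a) - log (b a)) := by
  set t := ∑ a, q a with ht
  set s := ∑ a, b a with hs
  have ht0 : 0 ≤ t := sum_nonneg fun a _ => hq a
  rcases ht0.eq_or_lt with h0 | h0
  · have : ∀ a, q a = 0 := fun a => (sum_eq_zero_iff_of_nonneg fun a _ => hq a).1 h0.symm a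
      (mem_univ a)
    simp [eta, this]
  have hs0 : 0 < s := by
    refine (sum_nonneg fun a _ => hb a).lt_of_ne fun h => h0.ne' ?_
    exact sum_eq_zero fun a _ => hqb a
      ((sum_eq_zero_iff_of_nonneg fun a _ => hb a).1 h.symm a (mem_univ a))
  -- Rescaling `b` to the total mass of `q` makes the right side of Gibbs' inequality vanish.
  have key := sum_mul_log_sub_log_le (a := q) (b := fun a => t / s * b a) hq
    (fun a => mul_nonneg (by positivity) (hb a))
    (fun a h => hqb a (by
      rcases mul_eq_zero.1 h with h | h
      · exact absurd h (by positivity)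
      · exact h))
  rw [← mul_sum, ← hs, ← ht, div_mul_cancel₀ _ hs0.ne', sub_self] at key
  rw [eta_eq_sum, ← sub_nonpos, ← sum_sub_distrib, ← ht]
  refine le_trans (le_of_eq (sum_congr rfl fun a _ => ?_)) key
  by_cases hqa : q a = 0
  · simp [hqa]
  rw [log_mul (by positivity) fun h => hqa (hqb a h), log_div h0.ne' hs0.ne']
  ring

/-- Entropy is superadditive (equivalently, concave). -/
lemma sum_eta_le {q : B → A → ℝ} (hq : ∀ b a, 0 ≤ q b a) :
    ∑ b, eta (q b) ≤ eta fun a => ∑ b, q b a := by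
  have h1 : ∀ b, eta (q b) ≤
      ∑ a, q b a * (log (∑ a, ∑ b, q b a) - log (∑ b, q b a)) := fun b =>
    eta_le_cross (hq b) (fun a => sum_nonneg fun b _ => hq b a) fun a h =>
      (sum_eq_zero_iff_of_nonneg fun b _ => hq b a).1 h b (mem_univ b)
  refine (sum_le_sum fun b _ => h1 b).trans (le_of_eq ?_)
  rw [eta_eq_sum, sum_comm]
  simp only [sum_mul]

lemma eta_comp_equiv (e : A ≃ B) (q : B → ℝ) : eta (fun a => q (e a)) = eta q := by
  simp only [eta]
  rw [e.sum_comp (fun b => negMulLog (q b)), e.sum_comp q]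

/-- The chain rule. -/
lemma eta_prod (q : A × B → ℝ) :
    eta q = eta (WAK.marginalFst q) + ∑ a, eta fun b => q (a, b) := by
  simp only [eta, WAK.marginalFst, Fintype.sum_prod_type, sum_sub_distrib]
  ring

/-- Conditioning on a function `g`: the chain rule for the graph of `g`. -/
lemma sum_eta_fiber [DecidableEq B] (g : A → B) (q : A → ℝ) :
    ∑ b, eta (fun a => if g a = b then q a else 0) =
      eta q - eta fun b => ∑ a, if g a = b then q a else 0 := by
  have h : ∀ a, ∑ b, negMulLog (if g a = b then q a else 0) = negMulLog (q a) := fun a => by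
    simp only [apply_ite negMulLog, negMulLog_zero, sum_ite_eq, mem_univ, if_true]
  simp only [eta, sum_sub_distrib]
  rw [sum_comm, sum_comm (f := fun b a => if g a = b then q a else 0)]
  simp [h]

/-- This is the cross-entropy bound against the indicator of `s`. -/
lemma eta_le_mul_log_card {q : A → ℝ} (hq : ∀ a, 0 ≤ q a) (s : Finset A)
    (hs : ∀ a, a ∉ s → q a = 0) : eta q ≤ (∑ a, q a) * log #s := by
  classical
  refine (eta_le_cross (b := fun a => if a ∈ s then 1 else 0) hq
    (fun a => by split_ifs <;> norm_num) fun a h => hs a fun ha => by simp [ha] at h).trans ?_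
  rw [sum_mul]
  refine le_of_eq (sum_congr rfl fun a _ => ?_)
  by_cases ha : a ∈ s
  · simp [ha]
  · simp [hs a ha]

end Gibbs

lemma sum_eq_sum_of_embedding {ι κ F : Type*} [Fintype ι] [Fintype κ] [AddCommMonoid F]
    (e : ι ↪ κ) {f : ι → F} {g : κ → F} (h1 : ∀ i, g (e i) = f i)
    (h2 : ∀ j, j ∉ Set.range e → g j = 0) : ∑ j, g j = ∑ i, f i := by
  classical
  refine (sum_of_injOn e e.injective.injOn (by simp) (fun j _ hj => ?_) fun i _ => (h1 i).symm).symm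
  exact h2 j (by simpa using hj)

/-! ### Convex hulls in finite dimension. -/

section Caratheodory

open Module

variable {E : Type*} [AddCommGroup E] [Module ℝ E] [FiniteDimensional ℝ E]

/-- Carathéodory's theorem with a fixed number of points. -/
lemma exists_fin_of_mem_convexHull {s : Set E} {x : E} (hx : x ∈ convexHull ℝ s) :
    ∃ w ∈ stdSimplex ℝ (Fin (finrank ℝ E + 1)), ∃ z : Fin (finrank ℝ E + 1) → E,
      (∀ i, z i ∈ s) ∧ ∑ i, w i • z i = x := by
  classical
  obtain ⟨z₀, hz₀⟩ := convexHull_nonempty_iff.1 ⟨x, hx⟩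
  obtain ⟨ι, _, z, w, hz, hind, hw, hw1, rfl⟩ := eq_pos_convex_span_of_mem_convexHull hx
  have hcard : Fintype.card ι ≤ Fintype.card (Fin (finrank ℝ E + 1)) := by
    rw [Fintype.card_fin]
    exact hind.card_le_finrank_succ.trans (Nat.succ_le_succ (Submodule.finrank_le _))
  obtain ⟨e⟩ := Function.Embedding.nonempty_of_card_le hcard
  refine ⟨Function.extend e w 0, ⟨fun j => ?_, ?_⟩, Function.extend e z fun _ => z₀, fun j => ?_, ?_⟩
  · by_cases hj : ∃ i, e i = j
    · obtain ⟨i, rfl⟩ := hj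
      rw [e.injective.extend_apply]; exact (hw i).le
    · rw [Function.extend_apply' _ _ _ hj]; rfl
  · rw [← hw1]
    refine sum_eq_sum_of_embedding e (fun i => e.injective.extend_apply _ _ _) fun j hj => ?_
    rw [Function.extend_apply' _ _ _ hj]; rfl
  · by_cases hj : ∃ i, e i = j
    · obtain ⟨i, rfl⟩ := hj
      rw [e.injective.extend_apply]; exact hz ⟨i, rfl⟩
    · rw [Function.extend_apply' _ _ _ hj]; exact hz₀
  · refine sum_eq_sum_of_embedding e (fun i => ?_) fun j hj => ?_
    · rw [e.injective.extend_apply, e.injective.extend_apply]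
    · rw [Function.extend_apply' _ _ _ hj]; simp

/-- Carathéodory's theorem for points of an affine hyperplane that misses the origin. -/
lemma exists_fintype_card_le_finrank {s : Set E} {x : E} (l : E →ₗ[ℝ] ℝ) (hl : ∀ z ∈ s, l z = 1)
    (hx : x ∈ convexHull ℝ s) :
    ∃ k ≤ finrank ℝ E, ∃ (w : Fin k → ℝ) (z : Fin k → E), (∀ i, 0 ≤ w i) ∧ ∑ i, w i = 1 ∧
      (∀ i, z i ∈ s) ∧ ∑ i, w i • z i = x := by
  obtain ⟨ι, _, z, w, hz, hind, hw, hw1, rfl⟩ := eq_pos_convex_span_of_mem_convexHull hx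
  -- On the hyperplane `l = 1` a linear relation has coefficients summing to zero, so affine
  -- independence is linear independence. This saves one point over the general bound.
  have hlin : LinearIndependent ℝ z := by
    rw [Fintype.linearIndependent_iff]
    intro g hg
    have hg0 : ∑ i, g i = 0 := by
      have := congrArg l hg
      simpa [map_sum, hl _ (hz ⟨_, rfl⟩)] using this
    rw [affineIndependent_iff] at hind
    exact fun i => hind univ g hg0 hg i (mem_univ i)
  let e := (Fintype.equivFin ι).symm
  refine ⟨Fintype.card ι, hlin.fintype_card_le_finrank, w ∘ e, z ∘ e, fun i => (hw _).le, ?_,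
    fun i => hz ⟨_, rfl⟩, ?_⟩
  · rw [← hw1]; exact e.sum_comp w
  · exact e.sum_comp fun i => w i • z i

lemma IsCompact.convexHull_of_finiteDimensional [TopologicalSpace E] [IsTopologicalAddGroup E]
    [ContinuousSMul ℝ E] {s : Set E} (hs : IsCompact s) : IsCompact (convexHull ℝ s) := by
  have h : convexHull ℝ s = (fun p : (Fin (finrank ℝ E + 1) → ℝ) × (Fin (finrank ℝ E + 1) → E) =>
      ∑ i, p.1 i • p.2 i) '' (stdSimplex ℝ _ ×ˢ Set.univ.pi fun _ => s) := by
    refine Set.Subset.antisymm (fun x hx => ?_) ?_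
    · obtain ⟨w, hw, z, hz, rfl⟩ := exists_fin_of_mem_convexHull hx
      exact ⟨(w, z), ⟨hw, fun i _ => hz i⟩, rfl⟩
    · rintro _ ⟨⟨w, z⟩, ⟨hw, hz⟩, rfl⟩
      exact mem_convexHull_of_exists_fintype w z hw.1 hw.2 (fun i => hz i trivial) rfl
  rw [h]
  refine ((isCompact_stdSimplex ℝ _).prod (isCompact_univ_pi fun _ => hs)).image ?_
  fun_prop

end Caratheodory

/-! ### Single-letterization of entropies of words. -/

section SingleLetter

variable {X Y A B A' B' : Type*} [Fintype X] [Fintype Y] [Fintype A] [Fintype B] [Fintype A']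
  [Fintype B']

/-- A mass function on `X × Y` together with its entropies `H(X)`, `H(Y)`, `H(X, Y)`. -/
noncomputable def entropyPoint (p : X × Y → ℝ) : (X × Y → ℝ) × ℝ × ℝ × ℝ :=
  (p, eta (WAK.marginalFst p), eta (WAK.marginalSnd p), eta p)

variable (X Y) in
/-- The convex cone generated by the entropy points of mass functions: a sum over `w` of entropy
points consists of a mass function and the conditional entropies given `W`. -/
noncomputable def entropyCone : AddSubmonoid ((X × Y → ℝ) × ℝ × ℝ × ℝ) :=
  AddSubmonoid.closure (entropyPoint '' {p | ∀ z, 0 ≤ p z})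

variable (X Y) in
/-- Convex combinations of entropy points of probability mass functions. -/
noncomputable def entropyHull : Set ((X × Y → ℝ) × ℝ × ℝ × ℝ) :=
  convexHull ℝ (entropyPoint '' stdSimplex ℝ (X × Y))

lemma entropyPoint_smul (c : ℝ) (p : X × Y → ℝ) :
    entropyPoint (c • p) = c • entropyPoint p := by
  have h1 : WAK.marginalFst (c • p) = c • WAK.marginalFst p := by
    ext x; simp [WAK.marginalFst, mul_sum]
  have h2 : WAK.marginalSnd (c • p) = c • WAK.marginalSnd p := by
    ext x; simp [WAK.marginalSnd, mul_sum]
  simp [entropyPoint, h1, h2, eta_smul]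

lemma continuous_entropyPoint : Continuous (entropyPoint : (X × Y → ℝ) → _) := by
  unfold entropyPoint eta WAK.marginalFst WAK.marginalSnd
  fun_prop

lemma isCompact_entropyHull : IsCompact (entropyHull X Y) :=
  ((isCompact_stdSimplex ℝ _).image continuous_entropyPoint).convexHull_of_finiteDimensional

/-- Cone points add without renormalization, hull points form a compact set; dividing by the total
mass passes from the first to the second. For words of length `n` and total probability one, that
mass is `n`. -/
lemma exists_smul_of_mem_entropyCone [Nonempty (X × Y)] {k : (X × Y → ℝ) × ℝ × ℝ × ℝ}
    (hk : k ∈ entropyCone X Y) :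
    0 ≤ ∑ z, k.1 z ∧ ∃ c ∈ entropyHull X Y, k = (∑ z, k.1 z) • c := by
  classical
  have hne : (entropyHull X Y).Nonempty := convexHull_nonempty_iff.2
    (Set.Nonempty.image _ ⟨_, single_mem_stdSimplex ℝ (Classical.arbitrary (X × Y))⟩)
  refine AddSubmonoid.closure_induction ?_ ?_ ?_ hk
  · rintro _ ⟨p, hp, rfl⟩
    have hp' : ∀ z, 0 ≤ p z := hp
    have h0 : 0 ≤ ∑ z, p z := sum_nonneg fun z _ => hp' z
    refine ⟨h0, ?_⟩
    change ∃ c ∈ entropyHull X Y, entropyPoint p = (∑ z, p z) • c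
    rcases h0.eq_or_lt with h | h
    · have : p = 0 := funext fun z =>
        (sum_eq_zero_iff_of_nonneg fun z _ => hp' z).1 h.symm z (mem_univ z)
      obtain ⟨c, hc⟩ := hne
      refine ⟨c, hc, ?_⟩
      rw [← h, this, ← zero_smul ℝ (0 : X × Y → ℝ), entropyPoint_smul, zero_smul, zero_smul]
    · refine ⟨entropyPoint ((∑ z, p z)⁻¹ • p), subset_convexHull _ _ ⟨_, ⟨fun z => ?_, ?_⟩, rfl⟩, ?_⟩
      · exact mul_nonneg (by positivity) (hp' z)
      · simp only [Pi.smul_apply, smul_eq_mul, ← mul_sum]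
        exact inv_mul_cancel₀ h.ne'
      · rw [entropyPoint_smul, smul_inv_smul₀ h.ne']
  · obtain ⟨c, hc⟩ := hne
    exact ⟨by simp, c, hc, by simp⟩
  · rintro k l - - ⟨hk0, c, hc, hk⟩ ⟨hl0, d, hd, hl⟩
    have hsum : ∑ z, (k + l).1 z = ∑ z, k.1 z + ∑ z, l.1 z := by simp [sum_add_distrib]
    rw [hsum]
    set s := ∑ z, k.1 z
    set t := ∑ z, l.1 z
    refine ⟨add_nonneg hk0 hl0, ?_⟩
    rcases (add_nonneg hk0 hl0).eq_or_lt with h | h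
    · have hs : s = 0 := by linarith
      have ht : t = 0 := by linarith
      exact ⟨c, hc, by rw [hk, hl, hs, ht]; simp⟩
    · refine ⟨(s / (s + t)) • c + (t / (s + t)) • d, (convex_convexHull ℝ _) hc hd (by positivity)
        (by positivity) (by field_simp), ?_⟩
      rw [smul_add, smul_smul, smul_smul, mul_div_cancel₀ _ h.ne', mul_div_cancel₀ _ h.ne',
        ← hk, ← hl]

/-- Given a type `m (a, b)` on `X × Y` for each `(a, b)`, every mass function on `A × B` is
dominated by a point of the single-letter entropy cone over its average type. -/
def SingleLetterizes (m : A × B → X × Y → ℝ) : Prop :=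
  ∀ q : A × B → ℝ, (∀ t, 0 ≤ q t) → ∃ k ∈ entropyCone X Y,
    (∀ z, k.1 z = ∑ t, q t * m t z) ∧ k.2.1 ≤ eta (WAK.marginalFst q) ∧
      k.2.2.1 ≤ eta (WAK.marginalSnd q) ∧ k.2.2.2 = eta q

lemma SingleLetterizes.of_equiv {m : A × B → X × Y → ℝ} (h : SingleLetterizes m)
    (e : A' ≃ A) (f : B' ≃ B) : SingleLetterizes fun t : A' × B' => m (e t.1, f t.2) := by
  intro q hq
  obtain ⟨k, hk, h1, h2, h3, h4⟩ := h (fun t => q (e.symm t.1, f.symm t.2)) fun t => hq _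
  refine ⟨k, hk, fun z => ?_, h2.trans_eq ?_, h3.trans_eq ?_, h4.trans ?_⟩
  · rw [h1, ← (e.prodCongr f).sum_comp]
    simp only [Equiv.prodCongr_apply, Prod.map, Equiv.symm_apply_apply]
  · rw [← eta_comp_equiv e.symm (WAK.marginalFst q)]
    congr 1; ext a
    exact f.symm.sum_comp fun b => q (e.symm a, b)
  · rw [← eta_comp_equiv f.symm (WAK.marginalSnd q)]
    congr 1; ext b
    exact e.symm.sum_comp fun a => q (a, f.symm b)
  · exact eta_comp_equiv (e.prodCongr f).symm q

lemma singleLetterizes_of_subsingleton [Subsingleton A] [Subsingleton B] :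
    SingleLetterizes (fun (_ : A × B) (_ : X × Y) => 0) := fun q _ =>
  ⟨0, zero_mem _, by simp, by simp [eta_of_subsingleton], by simp [eta_of_subsingleton],
    by simp [eta_of_subsingleton]⟩

/-- The chain rule followed by extra conditioning: `H(X, A) = H(X) + H(A|X) ≥ H(X) + H(A|X, Y)`. -/
lemma sum_eta_marginal_le (q : X × A → Y × B → ℝ) (hq : ∀ s t, 0 ≤ q s t) :
    eta (fun x => ∑ y, ∑ a, ∑ b, q (x, a) (y, b)) +
      ∑ x, ∑ y, eta (fun a => ∑ b, q (x, a) (y, b)) ≤ eta fun s => ∑ t, q s t := by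
  rw [eta_prod]
  refine add_le_add (le_of_eq ?_) (sum_le_sum fun x _ => ?_)
  · congr 1; ext x
    simp only [WAK.marginalFst, Fintype.sum_prod_type]
    rw [sum_comm]
  · refine (sum_eta_le fun y a => sum_nonneg fun b _ => hq _ _).trans (le_of_eq ?_)
    simp only [Fintype.sum_prod_type]

/-- Induction step: split off the first letter pair and condition the rest on both of its letters.
The joint entropy splits exactly; each marginal entropy can only drop, since the other source's
letter is extra conditioning. -/
lemma SingleLetterizes.prod [DecidableEq X] [DecidableEq Y] {m : A × B → X × Y → ℝ}
    (h : SingleLetterizes m) : SingleLetterizes fun (t : (X × A) × (Y × B)) z =>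
      (if (t.1.1, t.2.1) = z then 1 else 0) + m (t.1.2, t.2.2) z := by
  intro q hq
  choose k hk h1 h2 h3 h4 using fun z : X × Y => h (fun t => q ((z.1, t.1), (z.2, t.2)))
    fun t => hq _
  let q₁ : X × Y → ℝ := fun z => ∑ a, ∑ b, q ((z.1, a), (z.2, b))
  have hq₁ : ∀ z, 0 ≤ q₁ z := fun z => sum_nonneg fun a _ => sum_nonneg fun b _ => hq _
  refine ⟨entropyPoint q₁ + ∑ z, k z, add_mem (AddSubmonoid.subset_closure ⟨q₁, hq₁, rfl⟩)
    (sum_mem fun z _ => hk z), fun z => ?_, ?_, ?_, ?_⟩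
  · have e : ∀ F : (X × A) × (Y × B) → ℝ, ∑ t, F t =
        ∑ z : X × Y, ∑ s : A × B, F ((z.1, s.1), (z.2, s.2)) := fun F => by
      rw [← (Equiv.prodProdProdComm X Y A B).sum_comp, Fintype.sum_prod_type]; rfl
    rw [e]
    simp only [mul_add, sum_add_distrib, mul_ite, mul_one, mul_zero, Prod.fst_add, Pi.add_apply,
      Prod.fst_sum, Finset.sum_apply, h1, entropyPoint]
    congr 1
    rw [sum_comm]
    simp [q₁, Fintype.sum_prod_type]
  · have := sum_eta_marginal_le (fun s t => q (s, t)) fun s t => hq _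
    refine le_trans ?_ this
    simp only [Prod.snd_add, Prod.fst_add, Prod.snd_sum, Prod.fst_sum, entropyPoint]
    refine add_le_add le_rfl ?_
    rw [Fintype.sum_prod_type]
    exact sum_le_sum fun x _ => sum_le_sum fun y _ => h2 (x, y)
  · have := sum_eta_marginal_le (fun s t => q (t, s)) fun s t => hq _
    refine le_trans ?_ this
    simp only [Prod.snd_add, Prod.fst_add, Prod.snd_sum, Prod.fst_sum, entropyPoint]
    refine add_le_add (le_of_eq ?_) ?_
    · congr 1; ext y
      exact sum_congr rfl fun x _ => sum_comm
    rw [Fintype.sum_prod_type_right]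
    exact sum_le_sum fun x _ => sum_le_sum fun y _ => h3 (y, x)
  · simp only [Prod.snd_add, Prod.snd_sum, entropyPoint, h4]
    rw [← eta_comp_equiv (Equiv.prodProdProdComm X Y A B),
      eta_prod fun t => q (Equiv.prodProdProdComm X Y A B t)]
    refine congrArg₂ (· + ·) (congrArg eta (funext fun z => ?_)) rfl
    simp [WAK.marginalFst, q₁, Fintype.sum_prod_type]

/-- The number of occurrences of each pair of letters in a pair of words. -/
def pairCount [DecidableEq X] [DecidableEq Y] (n : ℕ) (t : (Fin n → X) × (Fin n → Y))
    (z : X × Y) : ℝ :=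
  ∑ i, if (t.1 i, t.2 i) = z then 1 else 0

lemma singleLetterizes_pairCount [DecidableEq X] [DecidableEq Y] (n : ℕ) :
    SingleLetterizes (pairCount (X := X) (Y := Y) n) := by
  induction n with
  | zero =>
    convert! singleLetterizes_of_subsingleton (X := X) (Y := Y) (A := Fin 0 → X) (B := Fin 0 → Y)
  | succ n ih =>
    have := ih.prod.of_equiv (Fin.consEquiv fun _ => X).symm (Fin.consEquiv fun _ => Y).symm
    convert this using 3 with t z
    rw [pairCount, Fin.sum_univ_succ]
    rfl

lemma sum_mul_pairCount [DecidableEq X] [DecidableEq Y] {n : ℕ}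
    (q : (Fin n → X) × (Fin n → Y) → ℝ) (f : X × Y → ℝ) :
    ∑ z, (∑ t, q t * pairCount n t z) * f z = ∑ t, q t * ∑ i, f (t.1 i, t.2 i) := by
  simp only [sum_mul]
  rw [sum_comm]
  refine sum_congr rfl fun t _ => ?_
  simp only [pairCount, mul_assoc, ← mul_sum, sum_mul]
  rw [sum_comm]
  simp

/-- Entropy of a random word is at most `n` times the entropy of its average letter. -/
lemma eta_word_le [DecidableEq X] {n : ℕ} {q : (Fin n → X) → ℝ} (hq : ∀ t, 0 ≤ q t) :
    eta q ≤ eta fun x => ∑ t, q t * ∑ i, if t i = x then 1 else 0 := by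
  set r : X → ℝ := fun x => ∑ t, q t * ∑ i, if t i = x then 1 else 0 with hr
  have hterm : ∀ t x, 0 ≤ q t * ∑ i, if t i = x then (1 : ℝ) else 0 := fun t x =>
    mul_nonneg (hq t) (sum_nonneg fun i _ => by split_ifs <;> norm_num)
  have hr0 : ∀ x, 0 ≤ r x := fun x => sum_nonneg fun t _ => hterm t x
  have hpos : ∀ t, q t ≠ 0 → ∀ i, r (t i) ≠ 0 := by
    intro t ht i h
    have h1 := (sum_eq_zero_iff_of_nonneg fun s _ => hterm s (t i)).1 h t (mem_univ t)
    have h2 := (mul_eq_zero.1 h1).resolve_left ht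
    have h3 := (sum_eq_zero_iff_of_nonneg fun j _ => by split_ifs <;> norm_num).1 h2 i (mem_univ i)
    simp at h3
  -- The comparison law is the product of the summed letter counts `r`, of total mass `(∑ x, r x) ^
  -- n`.
  have key := eta_le_cross (b := fun t => ∏ i, r (t i)) hq (fun t => prod_nonneg fun i _ => hr0 _)
    fun t h => by
      by_contra ht
      obtain ⟨i, -, hi⟩ := prod_eq_zero_iff.1 h
      exact hpos t ht i hi
  have hprod : ∑ t : Fin n → X, ∏ i, r (t i) = (∑ x, r x) ^ n := by
    rw [Fintype.sum_pow]
  rw [hprod] at key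
  refine key.trans (le_of_eq ?_)
  rw [eta_eq_sum]
  set L := log (∑ x, r x)
  have : ∀ t, q t * (log ((∑ x, r x) ^ n) - log (∏ i, r (t i))) =
      q t * ∑ i, (L - log (r (t i))) := by
    intro t
    by_cases ht : q t = 0
    · simp [ht]
    · rw [log_prod fun i _ => hpos t ht i, log_pow, sum_sub_distrib]
      simp [L]
  simp only [this]
  simp only [hr, sum_mul]
  rw [sum_comm]
  refine sum_congr rfl fun t _ => ?_
  simp only [mul_assoc, ← mul_sum, sum_mul]
  rw [sum_comm]
  simp

end SingleLetter

/-! ### Codes and the change of measure. -/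

section Code

variable {X Y A B M₀ M₂ : Type*} [Fintype X] [Fintype Y] [Fintype A] [Fintype B] [Fintype M₀]
  [Fintype M₂]

/-- If `B` can be decoded without error from `f₀ A` and `f₂ B`, the code sizes bound single-letter
conditional entropies. -/
lemma SingleLetterizes.exists_of_decodable {m : A × B → X × Y → ℝ} (hm : SingleLetterizes m)
    {q : A × B → ℝ} (hq : ∀ t, 0 ≤ q t) (hq1 : ∑ t, q t = 1) (f₀ : A → M₀) (f₂ : B → M₂)
    (g : M₀ × M₂ → B) (hg : ∀ a b, q (a, b) ≠ 0 → g (f₀ a, f₂ b) = b) :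
    ∃ k ∈ entropyCone X Y, (∀ z, k.1 z = ∑ t, q t * m t z) ∧
      eta q - log (Fintype.card M₀) ≤ k.2.2.2 ∧ k.2.2.1 ≤ log (Fintype.card M₂) ∧
      eta q - eta (WAK.marginalFst q) ≤ k.2.2.2 - k.2.1 := by
  classical
  -- Slices by helper message: sums over `i` are quantities conditioned on that message.
  let r : M₀ → A × B → ℝ := fun i t => if f₀ t.1 = i then q t else 0
  have hr : ∀ i t, 0 ≤ r i t := fun i t => by
    simp only [r]; split_ifs
    exacts [hq t, le_rfl]
  choose k hk h1 h2 h3 h4 using fun i => hm (r i) (hr i)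
  have hfst : ∀ i, WAK.marginalFst (r i) = fun a => if f₀ a = i then WAK.marginalFst q a else 0 := by
    intro i; ext a
    by_cases h : f₀ a = i <;> simp [WAK.marginalFst, r, h]
  have hlaw : (fun i => ∑ t : A × B, if f₀ t.1 = i then q t else 0) =
      fun i => ∑ a, if f₀ a = i then WAK.marginalFst q a else 0 := by
    ext i
    rw [Fintype.sum_prod_type]
    refine sum_congr rfl fun a _ => ?_
    by_cases h : f₀ a = i <;> simp [WAK.marginalFst, h]
  have hmass : ∑ i, ∑ t, r i t = 1 := by
    rw [sum_comm, ← hq1]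
    simp [r]
  have hZ : ∑ i, (k i).2.2.2 = eta q - eta fun i => ∑ t, r i t := by
    simp only [h4]
    exact sum_eta_fiber (fun t : A × B => f₀ t.1) q
  have hX : ∑ i, (k i).2.1 ≤ eta (WAK.marginalFst q) - eta fun i => ∑ t, r i t := by
    refine (sum_le_sum fun i _ => h2 i).trans (le_of_eq ?_)
    simp only [hfst]
    rw [sum_eta_fiber, ← hlaw]
  -- Given the helper message `i`, only words with `g (i, f₂ b) = b` have mass, and `f₂` is
  -- injective on them.
  have hY : ∑ i, (k i).2.2.1 ≤ log (Fintype.card M₂) := by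
    have hlog : (0 : ℝ) ≤ log (Fintype.card M₂) := log_natCast_nonneg _
    calc ∑ i, (k i).2.2.1 ≤ ∑ i, (∑ t, r i t) * log (Fintype.card M₂) := by
          refine sum_le_sum fun i _ => (h3 i).trans ?_
          refine (eta_le_mul_log_card (fun b => sum_nonneg fun a _ => hr i _)
            (univ.filter fun b => g (i, f₂ b) = b) fun b hb => ?_).trans ?_
          · refine sum_eq_zero fun a _ => ?_
            simp only [r]
            split_ifs with h
            · by_contra hne
              refine hb (mem_filter.2 ⟨mem_univ _, ?_⟩)
              rw [← h]; exact hg a b hne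
            · rfl
          · have hs : ∑ b, WAK.marginalSnd (r i) b = ∑ t, r i t := by
              rw [Fintype.sum_prod_type_right]; rfl
            change (∑ b, WAK.marginalSnd (r i) b) * _ ≤ _
            rw [hs]
            refine mul_le_mul_of_nonneg_left ?_ (sum_nonneg fun t _ => hr i t)
            rcases (univ.filter fun b => g (i, f₂ b) = b).eq_empty_or_nonempty with he | hne
            · simpa [he] using hlog
            refine log_le_log (by exact_mod_cast hne.card_pos) ?_
            norm_cast
            refine card_le_card_of_injOn f₂ (fun _ _ => mem_coe.2 (mem_univ _)) ?_
            intro b hb b' hb' h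
            have hb1 : g (i, f₂ b) = b := by simpa using hb
            have hb2 : g (i, f₂ b') = b' := by simpa using hb'
            rw [← hb1, ← hb2, h]
      _ = log (Fintype.card M₂) := by rw [← sum_mul, hmass, one_mul]
  have hM : (eta fun i => ∑ t, r i t) ≤ log (Fintype.card M₀) := by
    refine (eta_le_mul_log_card (fun i => sum_nonneg fun t _ => hr i t) univ
      fun i hi => absurd (mem_univ i) hi).trans (le_of_eq ?_)
    rw [hmass, one_mul, card_univ]
  refine ⟨∑ i, k i, sum_mem fun i _ => hk i, fun z => ?_, ?_, ?_, ?_⟩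
  · simp only [Prod.fst_sum, Finset.sum_apply, h1]
    rw [sum_comm]
    refine sum_congr rfl fun t _ => ?_
    rw [← sum_mul]
    simp [r]
  · simp only [Prod.snd_sum]; linarith
  · simp only [Prod.snd_sum, Prod.fst_sum]; exact hY
  · simp only [Prod.snd_sum, Prod.fst_sum]; linarith

lemma iid_nonneg {P : X × Y → ℝ} (hP : P ∈ stdSimplex ℝ (X × Y)) (n : ℕ)
    (t : (Fin n → X) × (Fin n → Y)) : 0 ≤ WAK.iid P n t :=
  prod_nonneg fun _ _ => hP.1 _

lemma sum_iid {P : X × Y → ℝ} (hP : P ∈ stdSimplex ℝ (X × Y)) (n : ℕ) :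
    ∑ t, WAK.iid P n t = 1 := by
  have h := Fintype.sum_pow P n
  rw [hP.2, one_pow] at h
  rw [h]
  exact ((Equiv.arrowProdEquivProdArrow (Fin n) (fun _ => X) fun _ => Y).sum_comp _).symm

/-- The probability of correct decoding. -/
noncomputable def correctProb {X Y M₀ M₂ : Type*} [Fintype X] [Fintype Y] [DecidableEq Y]
    {n : ℕ} (Φ : WAK.Code X Y M₀ M₂ n)
    (Q : (Fin n → X) × (Fin n → Y) → ℝ) : ℝ :=
  ∑ t, if Φ.dec (Φ.enc₀ t.1, Φ.enc₂ t.2) = t.2 then Q t else 0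

lemma errorProb_add_correctProb {X Y M₀ M₂ : Type*} [Fintype X] [Fintype Y] [DecidableEq Y]
    {n : ℕ} (Φ : WAK.Code X Y M₀ M₂ n)
    (Q : (Fin n → X) × (Fin n → Y) → ℝ) :
    WAK.errorProb Φ Q + correctProb Φ Q = ∑ t, Q t := by
  rw [WAK.errorProb, correctProb, ← Fintype.sum_prod_type', ← sum_add_distrib]
  refine sum_congr rfl fun t _ => ?_
  by_cases h : Φ.dec (Φ.enc₀ t.1, Φ.enc₂ t.2) = t.2 <;> simp [h]

/-- The change of measure: conditioning on correct decoding yields a single-letter point whose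
deviation from the source law `P` costs at most `-log ρ / n`, with `ρ` the probability of correct
decoding. -/
lemma exists_mem_entropyHull_of_code [DecidableEq Y] {P : X × Y → ℝ}
    (hP : P ∈ stdSimplex ℝ (X × Y)) {n : ℕ} (hn : 0 < n) (Φ : WAK.Code X Y M₀ M₂ n) {ρ : ℝ}
    (hρ : ρ = correctProb Φ (WAK.iid P n)) (hρ0 : 0 < ρ) :
    ∃ c ∈ entropyHull X Y, (∀ z, P z = 0 → c.1 z = 0) ∧
      -∑ z, c.1 z * log (P z) - c.2.2.2 ≤ (log (Fintype.card M₀) - log ρ) / n ∧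
      c.2.2.1 ≤ log (Fintype.card M₂) / n ∧
      log ρ / n ≤ c.2.2.2 - c.2.1 + eta (WAK.marginalFst c.1) + ∑ z, c.1 z * log (P z) := by
  classical
  have hne : Nonempty (X × Y) := by
    by_contra h
    rw [not_nonempty_iff] at h
    simpa using hP.2
  -- The source law conditioned on correct decoding.
  set q : (Fin n → X) × (Fin n → Y) → ℝ := fun t =>
    if Φ.dec (Φ.enc₀ t.1, Φ.enc₂ t.2) = t.2 then WAK.iid P n t / ρ else 0
  have hq : ∀ t, 0 ≤ q t := fun t => by
    simp only [q]; split_ifs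
    exacts [div_nonneg (iid_nonneg hP n t) hρ0.le, le_rfl]
  have hq1 : ∑ t, q t = 1 := by
    rw [← div_self hρ0.ne']
    nth_rewrite 1 [hρ]
    rw [correctProb, sum_div]
    refine sum_congr rfl fun t _ => ?_
    simp only [q, ite_div, zero_div]
  have hqP : ∀ t, q t ≠ 0 → ∀ i, P (t.1 i, t.2 i) ≠ 0 := by
    intro t ht i hi
    refine ht ?_
    have : WAK.iid P n t = 0 := prod_eq_zero (mem_univ i) hi
    simp [q, this]
  obtain ⟨k, hk, h1, h2, h3, h4⟩ := (singleLetterizes_pairCount (X := X) (Y := Y) n).exists_of_decodable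
    hq hq1 Φ.enc₀ Φ.enc₂ Φ.dec (fun a b h => by
      by_contra hne
      exact h (by simp [q, hne]))
  have hn' : (0 : ℝ) < n := by exact_mod_cast hn
  have hfun : ∀ f : X × Y → ℝ, ∑ z, k.1 z * f z = ∑ t, q t * ∑ i, f (t.1 i, t.2 i) := fun f => by
    simp only [h1]
    exact sum_mul_pairCount q f
  have hkmass : ∑ z, k.1 z = n := by
    have := hfun fun _ => 1
    simpa [← sum_mul, hq1] using this
  -- On the support of `q`, `-log q` is `log ρ` minus the log-likelihood under the i.i.d. law, and
  -- the latter depends only on letter counts.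
  have hetaq : eta q = log ρ - ∑ z, k.1 z * log (P z) := by
    rw [hfun fun z => log (P z), eta, hq1, negMulLog_one, sub_zero, ← one_mul (log ρ), ← hq1, sum_mul,
      ← sum_sub_distrib]
    refine sum_congr rfl fun t _ => ?_
    by_cases ht : q t = 0
    · simp [ht]
    have hdec : Φ.dec (Φ.enc₀ t.1, Φ.enc₂ t.2) = t.2 := by
      by_contra h; exact ht (by simp [q, h])
    have hval : q t = (∏ i, P (t.1 i, t.2 i)) / ρ := by simp [q, hdec, WAK.iid]
    have hprod : ∏ i, P (t.1 i, t.2 i) ≠ 0 := prod_ne_zero_iff.2 fun i _ => hqP t ht i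
    rw [← log_prod fun i _ => hqP t ht i, negMulLog]
    nth_rewrite 2 [hval]
    rw [log_div hprod hρ0.ne']
    ring
  have hetaX : eta (WAK.marginalFst q) ≤ eta (WAK.marginalFst k.1) := by
    refine (eta_word_le fun a => sum_nonneg fun b _ => hq _).trans (le_of_eq ?_)
    congr 1; ext x
    have := hfun fun z => if z.1 = x then 1 else 0
    rw [Fintype.sum_prod_type, Fintype.sum_prod_type] at this
    simp only [WAK.marginalFst, sum_mul]
    rw [← this]
    simp
  obtain ⟨-, c, hc, hkc⟩ := exists_smul_of_mem_entropyCone hk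
  rw [hkmass] at hkc
  have e1 : ∀ z, k.1 z = n * c.1 z := fun z => by rw [hkc]; rfl
  have e2 : k.2.1 = n * c.2.1 := by rw [hkc]; rfl
  have e3 : k.2.2.1 = n * c.2.2.1 := by rw [hkc]; rfl
  have e4 : k.2.2.2 = n * c.2.2.2 := by rw [hkc]; rfl
  have e5 : ∑ z, k.1 z * log (P z) = n * ∑ z, c.1 z * log (P z) := by
    simp only [e1, mul_sum, mul_assoc]
  have e6 : eta (WAK.marginalFst k.1) = n * eta (WAK.marginalFst c.1) := by
    rw [← eta_smul]
    congr 1; ext x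
    simp [WAK.marginalFst, e1, mul_sum]
  refine ⟨c, hc, fun z hz => ?_, ?_, ?_, ?_⟩
  · have h := hfun fun z' => if z' = z then 1 else 0
    have h0 : ∀ t, q t * ∑ i, (if (t.1 i, t.2 i) = z then (1 : ℝ) else 0) = 0 := fun t => by
      by_cases ht : q t = 0
      · simp [ht]
      · rw [sum_eq_zero, mul_zero]
        intro i _
        rw [if_neg]
        intro h; exact hqP t ht i (h ▸ hz)
    simp only [h0] at h
    simpa [e1, hn.ne'] using h
  · rw [le_div_iff₀ hn']; linarith
  · rw [le_div_iff₀ hn']; linarith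
  · rw [div_le_iff₀ hn']; linarith

end Code

/-! ### From zero divergence to the single-letter region. -/

section Region

variable {X Y : Type*} [Fintype X] [Fintype Y]

lemma eta_eq_neg_sum {A : Type*} [Fintype A] {q : A → ℝ} (h : ∑ a, q a = 1) :
    eta q = -∑ a, q a * log (q a) := by
  simp [eta, h, negMulLog]

lemma entropy_eq_eta_div {A : Type*} [Fintype A] {q : A → ℝ} (h : ∑ a, q a = 1) :
    WAK.entropy q = eta q / log 2 := by
  rw [eta_eq_neg_sum h, WAK.entropy, neg_div, sum_div]
  simp only [logb, mul_div_assoc]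

lemma sum_marginalFst {A B : Type*} [Fintype A] [Fintype B] (q : A × B → ℝ) :
    ∑ a, WAK.marginalFst q a = ∑ t, q t := by
  rw [Fintype.sum_prod_type]; rfl

/-- The points of the hull at which `Y` is, given `X` and the auxiliary variable, distributed
according to the conditional law of `P`. -/
def markovPoints (P : X × Y → ℝ) : Set ((X × Y → ℝ) × ℝ × ℝ) :=
  (fun p => (p, eta (WAK.marginalFst p), eta (WAK.marginalSnd p))) ''
    {p | p ∈ stdSimplex ℝ (X × Y) ∧
      ∀ x y, p (x, y) * WAK.marginalFst P x = WAK.marginalFst p x * P (x, y)}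

/-- A point of the hull at zero divergence from the Markov law `P_{W|X} P_{XY}` has law `P` and is
a mixture of laws satisfying the Markov condition. -/
lemma markov_of_divergence_nonpos {P : X × Y → ℝ} (hP : P ∈ stdSimplex ℝ (X × Y))
    {c : (X × Y → ℝ) × ℝ × ℝ × ℝ} (hc : c ∈ entropyHull X Y) (hcP : ∀ z, P z = 0 → c.1 z = 0)
    (hD : 0 ≤ c.2.2.2 - c.2.1 + eta (WAK.marginalFst c.1) + ∑ z, c.1 z * log (P z)) :
    c.1 = P ∧
      c.2.2.2 - c.2.1 + eta (WAK.marginalFst c.1) + ∑ z, c.1 z * log (P z) ≤ 0 ∧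
      (c.1, c.2.1, c.2.2.1) ∈ convexHull ℝ (markovPoints P) := by
  obtain ⟨ι, _, z, w, hz, -, hw, hw1, hsum⟩ := eq_pos_convex_span_of_mem_convexHull hc
  choose p hp hpz using fun i => hz ⟨i, rfl⟩
  have hc1 : ∀ t, c.1 t = ∑ i, w i * p i t := fun t => by
    simp [← hsum, ← hpz, Prod.fst_sum, Finset.sum_apply, entropyPoint]
  have hcX : c.2.1 = ∑ i, w i * eta (WAK.marginalFst (p i)) := by
    simp [← hsum, ← hpz, Prod.fst_sum, Prod.snd_sum, entropyPoint]
  have hcY : c.2.2.1 = ∑ i, w i * eta (WAK.marginalSnd (p i)) := by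
    simp [← hsum, ← hpz, Prod.fst_sum, Prod.snd_sum, entropyPoint]
  have hcZ : c.2.2.2 = ∑ i, w i * eta (p i) := by
    simp [← hsum, ← hpz, Prod.snd_sum, entropyPoint]
  set pX := WAK.marginalFst c.1 with hpX
  have hpX_eq : ∀ x, pX x = ∑ i, w i * WAK.marginalFst (p i) x := fun x => by
    simp only [hpX, WAK.marginalFst, hc1, mul_sum]
    rw [sum_comm]
  have hm0 : ∀ i x, 0 ≤ WAK.marginalFst (p i) x := fun i x => sum_nonneg fun y _ => (hp i).1 _
  have hpX0 : ∀ x, 0 ≤ pX x := fun x => by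
    rw [hpX_eq]; exact sum_nonneg fun i _ => mul_nonneg (hw i).le (hm0 i x)
  have hpz0 : ∀ i x y, WAK.marginalFst (p i) x = 0 → p i (x, y) = 0 := fun i x y h =>
    (sum_eq_zero_iff_of_nonneg fun y _ => (hp i).1 (x, y)).1 h y (mem_univ y)
  have hmz0 : ∀ i x, pX x = 0 → WAK.marginalFst (p i) x = 0 := fun i x h => by
    rw [hpX_eq] at h
    exact (mul_eq_zero.1 ((sum_eq_zero_iff_of_nonneg fun i _ =>
      mul_nonneg (hw i).le (hm0 i x)).1 h i (mem_univ i))).resolve_left (hw i).ne'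
  have hPz0 : ∀ i t, P t = 0 → p i t = 0 := fun i t h => by
    have h := hcP t h
    rw [hc1] at h
    exact (mul_eq_zero.1 ((sum_eq_zero_iff_of_nonneg fun i _ =>
      mul_nonneg (hw i).le ((hp i).1 t)).1 h i (mem_univ i))).resolve_left (hw i).ne'
  let a : ι × X × Y → ℝ := fun s => w s.1 * p s.1 s.2
  -- `a` is the law of `(W, X, Y)` and `b` is `P_{W|X} P_{XY}`, with `P_{W|X}` computed from `a`.
  -- Where `pX` vanishes, division by zero makes `b` zero, so `b` may have mass below one; Gibbs'
  -- inequality needs only this upper bound.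
  let b : ι × X × Y → ℝ := fun s => w s.1 * WAK.marginalFst (p s.1) s.2.1 * P s.2 / pX s.2.1
  have ha : ∀ s, 0 ≤ a s := fun s => mul_nonneg (hw _).le ((hp _).1 _)
  have hb : ∀ s, 0 ≤ b s := fun s =>
    div_nonneg (mul_nonneg (mul_nonneg (hw _).le (hm0 _ _)) (hP.1 _)) (hpX0 _)
  have hab : ∀ s, b s = 0 → a s = 0 := by
    rintro ⟨i, x, y⟩ h
    have hp0 : p i (x, y) = 0 := by
      rcases div_eq_zero_iff.1 h with h | h
      · rcases mul_eq_zero.1 h with h | h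
        · exact hpz0 i x y ((mul_eq_zero.1 h).resolve_left (hw i).ne')
        · exact hPz0 i _ h
      · exact hpz0 i x y (hmz0 i x h)
    simp [a, hp0]
  have hasum : ∑ s, a s = 1 := by
    rw [Fintype.sum_prod_type, ← hw1]
    refine sum_congr rfl fun i _ => ?_
    simp only [a]
    rw [← mul_sum, (hp i).2, mul_one]
  have hbz : ∀ t, ∑ i, b (i, t) ≤ P t := by
    intro t
    simp only [b]
    rw [← sum_div, ← sum_mul, ← hpX_eq]
    by_cases h : pX t.1 = 0
    · rw [h]; simpa using hP.1 t
    · rw [mul_div_cancel_left₀ _ h]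
  have hbsum : ∑ s, b s ≤ 1 := by
    rw [Fintype.sum_prod_type_right, ← hP.2]
    exact sum_le_sum fun t _ => hbz t
  have hmass : ∀ i, ∑ x, WAK.marginalFst (p i) x = 1 := fun i => by
    rw [sum_marginalFst]; exact (hp i).2
  have hc1sum : ∑ t, c.1 t = 1 := by
    simp only [hc1]
    rw [sum_comm, ← hw1]
    exact sum_congr rfl fun i _ => by rw [← mul_sum, (hp i).2, mul_one]
  -- The quantity assumed nonnegative is minus the divergence of `a` from `b`, hence also
  -- nonpositive.
  have hKL : ∑ s, a s * (log (b s) - log (a s)) =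
      c.2.2.2 - c.2.1 + eta pX + ∑ t, c.1 t * log (P t) := by
    have hterm : ∀ i x y, a (i, x, y) * (log (b (i, x, y)) - log (a (i, x, y))) =
        -(w i * (p i (x, y) * log (p i (x, y)))) +
          w i * (p i (x, y) * log (WAK.marginalFst (p i) x)) -
          w i * p i (x, y) * log (pX x) + w i * p i (x, y) * log (P (x, y)) := by
      intro i x y
      by_cases h : p i (x, y) = 0
      · simp [a, h]
      have h1 : WAK.marginalFst (p i) x ≠ 0 := fun h' => h (hpz0 i x y h')
      have h2 : pX x ≠ 0 := fun h' => h1 (hmz0 i x h')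
      have h3 : P (x, y) ≠ 0 := fun h' => h (hPz0 i _ h')
      have h4 := (hw i).ne'
      simp only [a, b]
      rw [log_div (by positivity) h2, log_mul (by positivity) h3, log_mul h4 h1, log_mul h4 h]
      ring
    have hZ' : ∀ i, eta (p i) = -∑ x, ∑ y, p i (x, y) * log (p i (x, y)) := fun i => by
      rw [eta_eq_neg_sum (hp i).2, Fintype.sum_prod_type]
    have hX' : ∀ i, eta (WAK.marginalFst (p i)) =
        -∑ x, ∑ y, p i (x, y) * log (WAK.marginalFst (p i) x) := fun i => by
      rw [eta_eq_neg_sum (hmass i)]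
      simp only [← sum_mul]; rfl
    have hpX' : eta pX = -∑ i, ∑ x, ∑ y, w i * p i (x, y) * log (pX x) := by
      rw [eta_eq_neg_sum (by rw [hpX, sum_marginalFst, hc1sum]), sum_comm]
      congr 1
      refine sum_congr rfl fun x _ => ?_
      rw [hpX_eq, sum_mul]
      refine sum_congr rfl fun i _ => ?_
      rw [← sum_mul, ← mul_sum, ← hpX_eq]; rfl
    have hP' : ∑ t, c.1 t * log (P t) = ∑ i, ∑ x, ∑ y, w i * p i (x, y) * log (P (x, y)) := by
      simp only [hc1, sum_mul]
      rw [sum_comm]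
      simp only [Fintype.sum_prod_type]
    rw [hcZ, hcX, hpX', hP']
    simp only [Fintype.sum_prod_type, hterm, hZ', hX', sum_add_distrib, sum_sub_distrib,
      sum_neg_distrib, mul_neg, ← mul_sum]
    ring
  have hgibbs := sum_mul_log_sub_log_le ha hb hab
  have heq := eq_of_le_sum_mul_log_sub_log ha hb hab (by rw [hKL]; linarith)
  -- Summing `a = b` over `W` gives `c.1 ≤ P`; both have mass one, so they agree.
  have hcle : ∀ t ∈ univ, c.1 t ≤ P t := fun t _ => by
    refine le_trans (le_of_eq ?_) (hbz t)
    rw [hc1]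
    exact sum_congr rfl fun i _ => heq (i, t)
  have hcPeq : c.1 = P := funext fun t =>
    (sum_eq_sum_iff_of_le hcle).1 (by rw [hc1sum, hP.2]) t (mem_univ t)
  refine ⟨hcPeq, by rw [← hKL]; linarith, mem_convexHull_of_exists_fintype w
    (fun i => (p i, eta (WAK.marginalFst (p i)), eta (WAK.marginalSnd (p i)))) (fun i => (hw i).le)
    hw1 (fun i => ⟨p i, ⟨hp i, fun x y => ?_⟩, rfl⟩) ?_⟩
  · have h := heq (i, x, y)
    simp only [a, b] at h
    rw [← hcPeq, ← hpX]
    rw [← hcPeq] at h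
    by_cases hx : pX x = 0
    · rw [hx, hmz0 i x hx]; ring
    · rw [eq_div_iff hx, mul_assoc, mul_assoc] at h
      exact mul_left_cancel₀ (hw i).ne' h
  · refine Prod.ext (funext fun t => ?_) (Prod.ext ?_ ?_)
    · simp [hc1, Prod.fst_sum, Finset.sum_apply]
    · simp [hcX, Prod.fst_sum, Prod.snd_sum]
    · simp [hcY, Prod.snd_sum]

/-- The mixture weights give the law of `W`, and Bayes' rule turns the mixture into a test channel;
the Markov condition on each component makes the channel reproduce it. The ambient space has
dimension `|X| |Y| + 2`, and total mass is the functional equal to one on all points, whence the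
size of `W`. -/
lemma mem_region_of_mem_convexHull {P : X × Y → ℝ} (hP : P ∈ stdSimplex ℝ (X × Y)) {hX hY : ℝ}
    (h : (P, hX, hY) ∈ convexHull ℝ (markovPoints P)) {r : ℝ × ℝ}
    (h₀ : eta (WAK.marginalFst P) - hX ≤ r.1 * log 2) (h₂ : hY ≤ r.2 * log 2) :
    r ∈ WAK.region P := by
  classical
  obtain ⟨k, hk, w, z, hw, hw1, hz, hsum⟩ := exists_fintype_card_le_finrank
    ((Fintype.linearCombination ℝ (fun _ : X × Y => (1 : ℝ))).comp (LinearMap.fst ℝ _ _))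
    (by
      rintro _ ⟨p, ⟨hp, -⟩, rfl⟩
      simpa [Fintype.linearCombination_apply] using hp.2) h
  choose p hp hpz using hz
  have hPeq : ∀ t, P t = ∑ i, w i * p i t := fun t => by
    have := congrArg (fun v => v.1 t) hsum
    simpa [← hpz, Prod.fst_sum, Finset.sum_apply] using this.symm
  have hXeq : hX = ∑ i, w i * eta (WAK.marginalFst (p i)) := by
    have := congrArg (fun v => v.2.1) hsum
    simpa [← hpz, Prod.fst_sum, Prod.snd_sum] using this.symm
  have hYeq : hY = ∑ i, w i * eta (WAK.marginalSnd (p i)) := by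
    have := congrArg (fun v => v.2.2) hsum
    simpa [← hpz, Prod.snd_sum] using this.symm
  set PX := WAK.marginalFst P with hPX
  have hPXeq : ∀ x, PX x = ∑ i, w i * WAK.marginalFst (p i) x := fun x => by
    simp only [hPX, WAK.marginalFst, hPeq, mul_sum]
    rw [sum_comm]
  have hm0 : ∀ i x, 0 ≤ WAK.marginalFst (p i) x := fun i x => sum_nonneg fun y _ => (hp i).1.1 _
  have hPX0 : ∀ x, 0 ≤ PX x := fun x => sum_nonneg fun y _ => hP.1 _
  -- At letters of probability zero any distribution will do; `w` is used.
  let V : X → Fin k → ℝ := fun x i => if PX x = 0 then w i else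
    w i * WAK.marginalFst (p i) x / PX x
  have hV : ∀ x, V x ∈ stdSimplex ℝ (Fin k) := by
    intro x
    by_cases hx : PX x = 0
    · simpa [V, hx] using ⟨hw, hw1⟩
    · simp only [V, hx, if_false]
      refine ⟨fun i => div_nonneg (mul_nonneg (hw i) (hm0 i x)) (hPX0 x), ?_⟩
      rw [← sum_div, ← hPXeq, div_self hx]
  have hjoint : ∀ i x y, WAK.jointWXY P V (i, x, y) = w i * p i (x, y) := by
    intro i x y
    simp only [WAK.jointWXY, V]
    by_cases hx : PX x = 0
    · have hP0 : P (x, y) = 0 := (sum_eq_zero_iff_of_nonneg fun y _ => hP.1 (x, y)).1 hx y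
        (mem_univ y)
      have hP0' := hP0
      rw [hPeq] at hP0'
      rw [hP0, zero_mul, (sum_eq_zero_iff_of_nonneg fun i _ =>
        mul_nonneg (hw i) ((hp i).1.1 _)).1 hP0' i (mem_univ i)]
    · rw [if_neg hx, mul_div_assoc', div_eq_iff hx, mul_assoc (w i), (hp i).2 x y]
      ring
  have hWX : WAK.jointWX P V = fun s => w s.1 * WAK.marginalFst (p s.1) s.2 := by
    ext ⟨i, x⟩
    simp only [WAK.jointWX, hjoint, ← mul_sum]; rfl
  have hWY : WAK.jointWY P V = fun s => w s.1 * WAK.marginalSnd (p s.1) s.2 := by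
    ext ⟨i, y⟩
    simp only [WAK.jointWY, hjoint, ← mul_sum]; rfl
  have hsX : ∀ i, ∑ x, WAK.marginalFst (p i) x = 1 := fun i => by
    rw [sum_marginalFst]; exact (hp i).1.2
  have hsY : ∀ i, ∑ y, WAK.marginalSnd (p i) y = 1 := fun i => by
    rw [← (hp i).1.2, Fintype.sum_prod_type_right]; rfl
  have hWX1 : WAK.marginalFst (WAK.jointWX P V) = w := by
    ext i
    rw [hWX, WAK.marginalFst]
    simp only [← mul_sum, hsX, mul_one]
  have hWX2 : WAK.marginalSnd (WAK.jointWX P V) = PX := by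
    ext x; simp only [hWX, WAK.marginalSnd]; rw [hPXeq]
  have hWY1 : WAK.marginalFst (WAK.jointWY P V) = w := by
    ext i
    rw [hWY, WAK.marginalFst]
    simp only [← mul_sum, hsY, mul_one]
  have hWXs : ∑ s, WAK.jointWX P V s = 1 := by
    rw [← sum_marginalFst, hWX1, hw1]
  have hWYs : ∑ s, WAK.jointWY P V s = 1 := by
    rw [← sum_marginalFst, hWY1, hw1]
  have hWXe : eta (WAK.jointWX P V) = eta w + hX := by
    rw [eta_prod, hWX1, hWX, hXeq]
    congr 1
    exact sum_congr rfl fun i _ => eta_smul (w i) _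
  have hWYe : eta (WAK.jointWY P V) = eta w + hY := by
    rw [eta_prod, hWY1, hWY, hYeq]
    congr 1
    exact sum_congr rfl fun i _ => eta_smul (w i) _
  have hlog2 : 0 < log 2 := log_pos one_lt_two
  refine ⟨k, hk.trans (le_of_eq (by simp)), V, hV, ?_, ?_⟩
  · rw [WAK.mutualInfo, hWX1, hWX2, entropy_eq_eta_div hw1, entropy_eq_eta_div hWXs,
      entropy_eq_eta_div (by rw [hPX, sum_marginalFst, hP.2]), hWXe, ← add_div, ← sub_div,
      div_le_iff₀ hlog2]
    linarith
  · rw [WAK.condEntropy, hWY1, entropy_eq_eta_div hw1, entropy_eq_eta_div hWYs, hWYe, ← sub_div,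
      div_le_iff₀ hlog2]
    linarith

/-- Points of the hull that nearly meet the single-letter constraints exist only for pairs in the
region. -/
lemma mem_region_of_forall_approx {P : X × Y → ℝ} (hP : P ∈ stdSimplex ℝ (X × Y)) {r : ℝ × ℝ}
    (h : ∀ δ > 0, ∃ c ∈ entropyHull X Y, (∀ z, P z = 0 → c.1 z = 0) ∧
      -∑ z, c.1 z * log (P z) - c.2.2.2 ≤ r.1 * log 2 + δ ∧ c.2.2.1 ≤ r.2 * log 2 + δ ∧
      -δ ≤ c.2.2.2 - c.2.1 + eta (WAK.marginalFst c.1) + ∑ z, c.1 z * log (P z)) :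
    r ∈ WAK.region P := by
  choose c hc h1 h2 h3 h4 using fun n : ℕ => h (1 / ((n : ℝ) + 1)) Nat.one_div_pos_of_nat
  obtain ⟨c₀, hc₀, φ, hφ, hlim⟩ := isCompact_entropyHull.tendsto_subseq hc
  have hδ : Filter.Tendsto (fun n => 1 / ((φ n : ℝ) + 1)) Filter.atTop (nhds 0) :=
    tendsto_one_div_add_atTop_nhds_zero_nat.comp hφ.tendsto_atTop
  have hcont : Continuous fun c : (X × Y → ℝ) × ℝ × ℝ × ℝ =>
      c.2.2.2 - c.2.1 + eta (WAK.marginalFst c.1) + ∑ z, c.1 z * log (P z) := by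
    unfold eta WAK.marginalFst
    fun_prop
  have hcont' : Continuous fun c : (X × Y → ℝ) × ℝ × ℝ × ℝ =>
      -∑ z, c.1 z * log (P z) - c.2.2.2 := by fun_prop
  have hcontY : Continuous fun c : (X × Y → ℝ) × ℝ × ℝ × ℝ => c.2.2.1 := by fun_prop
  have l1 : ∀ z, P z = 0 → c₀.1 z = 0 := fun z hz => by
    have hcz : Continuous fun c : (X × Y → ℝ) × ℝ × ℝ × ℝ => c.1 z := by fun_prop
    refine tendsto_nhds_unique ((hcz.tendsto c₀).comp hlim) ?_
    simp [Function.comp_def, h1 _ z hz]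
  have l2 : -∑ z, c₀.1 z * log (P z) - c₀.2.2.2 ≤ r.1 * log 2 + 0 :=
    le_of_tendsto_of_tendsto' ((hcont'.tendsto c₀).comp hlim) (hδ.const_add _) fun n => h2 (φ n)
  have l3 : c₀.2.2.1 ≤ r.2 * log 2 + 0 :=
    le_of_tendsto_of_tendsto' ((hcontY.tendsto c₀).comp hlim) (hδ.const_add _) fun n => h3 (φ n)
  have l4 : -0 ≤ c₀.2.2.2 - c₀.2.1 + eta (WAK.marginalFst c₀.1) + ∑ z, c₀.1 z * log (P z) :=
    le_of_tendsto_of_tendsto' hδ.neg ((hcont.tendsto c₀).comp hlim) fun n => h4 (φ n)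
  -- `hle` says `H(X) - H(X|W) ≤ H(X, Y) - H(X, Y|W)`, so `l2` bounds `I(W ∧ X)`.
  obtain ⟨e, hle, hmem⟩ := markov_of_divergence_nonpos hP hc₀ l1 (by linarith)
  rw [e] at hmem hle l2
  exact mem_region_of_mem_convexHull hP hmem (by linarith) (by linarith)

end Region

/-! ### Rates in nats and the strong converse. -/

lemma eventually_log_div_le_of_limsup_le (N : ℕ → ℕ) {r : ℝ}
    (h : Filter.limsup (fun n : ℕ => ((1 / (n : ℝ) * Real.logb 2 (N n) : ℝ) : EReal))
      Filter.atTop ≤ (r : EReal)) {δ : ℝ} (hδ : 0 < δ) :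
    ∀ᶠ n : ℕ in Filter.atTop, log (N n) / n ≤ r * log 2 + δ := by
  have hlog2 : 0 < log 2 := log_pos one_lt_two
  have hlt : (r : EReal) < ((r + δ / log 2 : ℝ) : EReal) := by
    rw [EReal.coe_lt_coe_iff]
    have : 0 < δ / log 2 := by positivity
    linarith
  filter_upwards [Filter.eventually_lt_of_limsup_lt (h.trans_lt hlt)] with n hn
  rw [EReal.coe_lt_coe_iff, logb] at hn
  have := mul_lt_mul_of_pos_right hn hlog2
  rw [add_mul, div_mul_cancel₀ _ hlog2.ne'] at this
  refine le_trans (le_of_eq ?_) this.le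
  field_simp

theorem corollary2 {X Y : Type*} [Fintype X] [Fintype Y] [DecidableEq Y]
    (P : X × Y → ℝ) (hP : P ∈ stdSimplex ℝ (X × Y))
    (r₀ r₂ : ℝ) (hr : (r₀, r₂) ∉ WAK.region P)
    (hr₀ : r₀ < WAK.entropy (WAK.marginalFst P))
    (M₀ M₂ : ℕ → Type*) [∀ n, Fintype (M₀ n)] [∀ n, Fintype (M₂ n)]
    (Φ : ∀ n, WAK.Code X Y (M₀ n) (M₂ n) n)
    (h₀ : Filter.limsup
      (fun n : ℕ => ((1 / (n : ℝ) * Real.logb 2 (Fintype.card (M₀ n)) : ℝ) : EReal))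
      Filter.atTop ≤ (r₀ : EReal))
    (h₂ : Filter.limsup
      (fun n : ℕ => ((1 / (n : ℝ) * Real.logb 2 (Fintype.card (M₂ n)) : ℝ) : EReal))
      Filter.atTop ≤ (r₂ : EReal)) :
    Filter.Tendsto (fun n => WAK.errorProb (Φ n) (WAK.iid P n)) Filter.atTop (nhds 1) := by
  have hsum : ∀ n, WAK.errorProb (Φ n) (WAK.iid P n) =
      1 - correctProb (Φ n) (WAK.iid P n) := fun n => by
    rw [eq_sub_iff_add_eq, errorProb_add_correctProb, sum_iid hP]
  suffices h : Filter.Tendsto (fun n => correctProb (Φ n) (WAK.iid P n)) Filter.atTop (nhds 0) by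
    simp only [hsum]
    simpa using h.const_sub 1
  have hnonneg : ∀ n, 0 ≤ correctProb (Φ n) (WAK.iid P n) := fun n =>
    sum_nonneg fun t _ => by
      split_ifs
      exacts [iid_nonneg hP n t, le_rfl]
  by_contra hlim
  refine hr ?_
  obtain ⟨ε, hε, hfreq⟩ : ∃ ε > 0, ∃ᶠ n in Filter.atTop, ε ≤ correctProb (Φ n) (WAK.iid P n) := by
    by_contra! hcon
    refine hlim (Metric.tendsto_nhds.2 fun ε hε => ?_)
    filter_upwards [hcon ε hε] with n hn
    rw [Real.dist_eq, sub_zero, abs_of_nonneg (hnonneg n)]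
    exact hn
  refine mem_region_of_forall_approx hP fun δ hδ => ?_
  have hε0 : ∀ᶠ n : ℕ in Filter.atTop, -(δ / 2) < log ε / n :=
    (tendsto_const_div_atTop_nhds_zero_nat (log ε)).eventually_const_lt (by linarith)
  -- One good `n` suffices for each `δ`. The helper bound carries both the rate excess and `-log ρ /
  -- n`, so each gets `δ / 2`.
  obtain ⟨n, hn, hn0, hnε, hM₀, hM₂⟩ := (hfreq.and_eventually ((Filter.eventually_gt_atTop 0).and
    (hε0.and ((eventually_log_div_le_of_limsup_le _ h₀ (half_pos hδ)).and
      (eventually_log_div_le_of_limsup_le _ h₂ hδ))))).exists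
  obtain ⟨c, hc, h1, h2, h3, h4⟩ := exists_mem_entropyHull_of_code hP hn0 (Φ n) rfl (hε.trans_le hn)
  have hlogε : log ε / n ≤ log (correctProb (Φ n) (WAK.iid P n)) / n := by gcongr
  rw [sub_div] at h2
  exact ⟨c, hc, h1, by linarith, h3.trans hM₂, by linarith⟩
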